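/- Let $\mathcal X\subseteq\mathbb R^n$ be bounded and let $K=\sup_{\mathbf x\in\mathcal X}\|\mathbf x\|_2$. Let $\mathbb P$ range over the probability distributions on $\mathbb R^n\times\mathbb R$ supported by $\mathcal X\times\{-1,+1\}$, and for given $\mathbb P$ let the training samples $(\mathbf x_i,y_i)_{i=1}^\infty$ be i.i.d. with law $\mathbb P$. Then there are random variables $\gamma_{m,c}=\gamma_{m,c}^{\mathbb P}$ ($m\ge 1$, $c>0$), where $\gamma_{m,c}$ is a measurable function of the first $m$ training samples (the function may depend on $\mathbb P$ and on $\mathcal X$), such that: 1. For every $c>0$, $\lim_{m\to\infty}\gamma_{m,c}=0$ almost surely, and the convergence is uniform in $\mathbb P$: for all $c,\varepsilon,\delta>0$ there is an $M$, depending only on $\mathcal X,c,\varepsilon,\delta$, such that $\Pr\big(\exists\, m\ge M:\ |\gamma_{m,c}|\ge\varepsilon\big)\le\delta$ for every $\mathbb P$. 2. For every such $\mathbb P$, every $c>0$, every $m\ge1$ and every realization $(\mathbf x_1,y_1),\dots,(\mathbf x_m,y_m)\in\mathcal X\times\{-1,+1\}$ of the training samples, the following bounds hold for all $(\mathbf w,b)\in\mathbb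 R^n\times\mathbb R$ simultaneously (the losses on the left being integrable, and $\mathrm{sgn}(0)=0$): $$\mathbb E_{(\mathbf x,y)\sim\mathbb P}\big(\mathbf 1_{y\neq \mathrm{sgn}(\langle\mathbf w,\mathbf x\rangle+b)}\big)\le \gamma_{m,c}+c\|\mathbf w\|_2+\frac1m\sum_{i=1}^m\max\big[1-y_i(\langle\mathbf w,\mathbf x_i\rangle+b),0\big],$$ $$\mathbb E_{(\mathbf x,y)\sim\mathbb P}\big(\max[1-y(\langle\mathbf w,\mathbf x\rangle+b),0]\big)\le \gamma_{m,c}\,(1+K\|\mathbf w\|_2+|b|)+c\|\mathbf w\|_2+\frac1m\sum_{i=1}^m\max\big[1-y_i(\langle\mathbf w,\mathbf x_i\rangle+b),0\big].$$ -/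

import Mathlib

open MeasureTheory ProbabilityTheory Filter Topology

universe u

/-- A labelled example `(x, y)`: a point `x ∈ ℝⁿ` with its Euclidean norm, and a real label `y`.
The labels are confined to `{-1, +1}` by the law of the examples. -/
abbrev LabelledExample (n : ℕ) : Type := EuclideanSpace ℝ (Fin n) × ℝ

/-- The set `X × {-1, +1}`. -/
def labelledSet {n : ℕ} (X : Set (EuclideanSpace ℝ (Fin n))) : Set (LabelledExample n) :=
  X ×ˢ ({-1, 1} : Set ℝ)

/-- `P` is a probability distribution supported by `X × {-1, +1}`
(the complement of this set is `P`-null). -/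
def IsLawOn {n : ℕ} (X : Set (EuclideanSpace ℝ (Fin n))) (P : Measure (LabelledExample n)) :
    Prop :=
  IsProbabilityMeasure P ∧ ∀ᵐ z ∂P, z ∈ labelledSet X

/-- `Z 0, Z 1, Z 2, …` are independent random examples on `(Ω, μ)`, all of law `P`. -/
structure IsIIDSample {n : ℕ} {Ω : Type u} [MeasurableSpace Ω] (μ : Measure Ω)
    (P : Measure (LabelledExample n)) (Z : ℕ → Ω → LabelledExample n) : Prop where
  isProbabilityMeasure : IsProbabilityMeasure μ
  measurable : ∀ i, Measurable (Z i)
  law : ∀ i, μ.map (Z i) = P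
  indep : iIndepFun Z μ

/-- The first `m` samples of a sequence, at the outcome `ω`. -/
def firstSamples {n : ℕ} {Ω : Type u} (Z : ℕ → Ω → LabelledExample n) (m : ℕ) (ω : Ω) :
    Fin m → LabelledExample n :=
  fun i => Z i ω

noncomputable section

/-- `K = sup_{x ∈ X} ‖x‖₂`. -/
def normBound {n : ℕ} (X : Set (EuclideanSpace ℝ (Fin n))) : ℝ :=
  sSup ((fun x => ‖x‖) '' X)

/-- The affine function `x ↦ ⟨w, x⟩ + b`. -/
def affineScore {n : ℕ} (w : EuclideanSpace ℝ (Fin n)) (b : ℝ) (x : EuclideanSpace ℝ (Fin n)) :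
    ℝ :=
  inner ℝ w x + b

/-- The 0-1 loss `1_{y ≠ sgn(⟨w, x⟩ + b)}`; here `sgn 0 = 0`, so that a point with zero score
counts as misclassified whatever its label. -/
def zeroOneLoss {n : ℕ} (w : EuclideanSpace ℝ (Fin n)) (b : ℝ) (z : LabelledExample n) : ℝ :=
  if z.2 ≠ Real.sign (affineScore w b z.1) then 1 else 0

/-- The hinge loss `max (1 - y (⟨w, x⟩ + b), 0)`. -/
def hingeLoss {n : ℕ} (w : EuclideanSpace ℝ (Fin n)) (b : ℝ) (z : LabelledExample n) : ℝ :=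
  max (1 - z.2 * affineScore w b z.1) 0

/-- The empirical hinge loss `(1/m) ∑ᵢ max (1 - yᵢ (⟨w, xᵢ⟩ + b), 0)` on a sample of size `m`. -/
def empiricalHingeLoss {n m : ℕ} (w : EuclideanSpace ℝ (Fin n)) (b : ℝ)
    (s : Fin m → LabelledExample n) : ℝ :=
  (1 / (m : ℝ)) * ∑ i, hingeLoss w b (s i)

end

/-! Both bounds reduce to one compact family of `[0,1]`-valued functions, `clippedHinge` with
parameters `(t, v, b)` in the sup-norm ball of radius `1 + K/c`; `γ` is `supSamplingGap` over this
ball.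

Hinge loss: divided by `T = 1 + K‖w‖ + |b|` it takes values in `[0,1]` and becomes the member with
parameters `(1, K w, b)/T`, of norm at most 1. Multiplying back by `T` gives the bound
(`integral_hingeLoss_le`), even without `c‖w‖`.

0-1 loss: if `c‖w‖ ≥ 1` nothing is to prove. Otherwise `K‖w‖ ≤ K/c`, and `b` can be truncated to the
ball without changing `min(hinge, 1)`, which dominates the 0-1 loss (`integral_zeroOneLoss_le`).

That `γ` tends to 0 uniformly in `P` is a finite net in the parameters, Hoeffding at each net point,
and a union bound over net and sample sizes; the geometric series involved does not see `P`
(`exists_measure_supSamplingGap_le`). -/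

/-- The expectation of `f` under `P` minus the average of `f` over the sample `s`. -/
noncomputable def samplingGap {α : Type*} [MeasurableSpace α] (P : Measure α) (f : α → ℝ) {m : ℕ}
    (s : Fin m → α) : ℝ :=
  ∫ z, f z ∂P - (1 / (m : ℝ)) * ∑ i, f (s i)

/-- The positive part of the supremum of the sampling gaps over a separable family of
functions. -/
noncomputable def supSamplingGap {α Θ : Type*} [MeasurableSpace α] [TopologicalSpace Θ]
    [TopologicalSpace.SeparableSpace Θ] [Nonempty Θ] (P : Measure α) (g : Θ → α → ℝ) {m : ℕ}
    (s : Fin m → α) : ℝ :=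
  max 0 (⨆ k, samplingGap P (g (TopologicalSpace.denseSeq Θ k)) s)

/-! ### Sampling gaps and their supremum over a separable family. -/

section SamplingGap

variable {α Θ : Type*} [MeasurableSpace α] {P : Measure α}

theorem measurable_samplingGap {f : α → ℝ} (hf : Measurable f) (m : ℕ) :
    Measurable (fun s : Fin m → α => samplingGap P f s) := by
  unfold samplingGap
  fun_prop

theorem integrable_of_mem_unitInterval [IsProbabilityMeasure P] {f : α → ℝ} (hf : Measurable f)
    (h01 : ∀ z, f z ∈ Set.Icc (0 : ℝ) 1) : Integrable f P :=
  Integrable.of_mem_Icc 0 1 hf.aemeasurable (ae_of_all _ h01)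

theorem samplingGap_le_one [IsProbabilityMeasure P] {f : α → ℝ} (hf : Measurable f)
    (h01 : ∀ z, f z ∈ Set.Icc (0 : ℝ) 1) {m : ℕ} (s : Fin m → α) : samplingGap P f s ≤ 1 := by
  have h1 : ∫ z, f z ∂P ≤ ∫ _, (1 : ℝ) ∂P :=
    integral_mono (integrable_of_mem_unitInterval hf h01) (integrable_const _)
      fun z => (h01 z).2
  have h2 : 0 ≤ (1 / (m : ℝ)) * ∑ i, f (s i) :=
    mul_nonneg (by positivity) (Finset.sum_nonneg fun i _ => (h01 _).1)
  simp only [integral_const, probReal_univ, smul_eq_mul, mul_one] at h1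
  unfold samplingGap
  linarith

theorem samplingGap_le_add [IsProbabilityMeasure P] {f f' : α → ℝ} (hf : Measurable f)
    (hf' : Measurable f')
    (h01 : ∀ z, f z ∈ Set.Icc (0 : ℝ) 1) (h01' : ∀ z, f' z ∈ Set.Icc (0 : ℝ) 1) {S : Set α}
    (hS : ∀ᵐ z ∂P, z ∈ S) {η : ℝ} (hη : ∀ z ∈ S, |f z - f' z| ≤ η) {m : ℕ} (hm : 1 ≤ m)
    {s : Fin m → α} (hs : ∀ i, s i ∈ S) :
    samplingGap P f s ≤ samplingGap P f' s + 2 * η := by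
  have i1 := integrable_of_mem_unitInterval (P := P) hf h01
  have i2 := integrable_of_mem_unitInterval (P := P) hf' h01'
  have h1 : ∫ z, f z ∂P ≤ ∫ z, (f' z + η) ∂P := by
    refine integral_mono_ae i1 (i2.add (integrable_const _)) ?_
    filter_upwards [hS] with z hz
    linarith [(abs_le.1 (hη z hz)).2]
  rw [integral_add i2 (integrable_const _)] at h1
  simp only [integral_const, probReal_univ, smul_eq_mul, one_mul] at h1
  have h2 : ∑ i, f' (s i) ≤ ∑ i, (f (s i) + η) :=
    Finset.sum_le_sum fun i _ => by linarith [(abs_le.1 (hη _ (hs i))).1]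
  rw [Finset.sum_add_distrib] at h2
  simp only [Finset.sum_const, Finset.card_univ, Fintype.card_fin, nsmul_eq_mul] at h2
  have hm0 : (0 : ℝ) < m := by exact_mod_cast hm
  have h3 : (1 / (m : ℝ)) * ∑ i, f' (s i) ≤ (1 / (m : ℝ)) * ∑ i, f (s i) + η := by
    calc (1 / (m : ℝ)) * ∑ i, f' (s i) ≤ (1 / (m : ℝ)) * (∑ i, f (s i) + m * η) := by gcongr
      _ = _ := by field_simp
  unfold samplingGap
  linarith

variable [TopologicalSpace Θ] [TopologicalSpace.SeparableSpace Θ] [Nonempty Θ] {g : Θ → α → ℝ}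

theorem measurable_supSamplingGap (hg : ∀ θ, Measurable (g θ)) (m : ℕ) :
    Measurable (fun s : Fin m → α => supSamplingGap P g s) :=
  measurable_const.max (.iSup fun _ => measurable_samplingGap (hg _) m)

theorem supSamplingGap_nonneg {m : ℕ} (s : Fin m → α) : 0 ≤ supSamplingGap P g s :=
  le_max_left _ _

theorem exists_le_samplingGap {m : ℕ} {s : Fin m → α} {ε : ℝ} (hε : 0 < ε)
    (h : ε ≤ supSamplingGap P g s) {ε' : ℝ} (hε' : ε' < ε) : ∃ θ, ε' < samplingGap P (g θ) s := by
  rcases le_max_iff.1 h with h | h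
  · exact absurd hε h.not_gt
  · obtain ⟨k, hk⟩ := exists_lt_of_lt_ciSup (hε'.trans_le h)
    exact ⟨_, hk⟩

/-- By dominated convergence the gap is continuous in `θ`, so a bound on the dense sequence passes
to all `θ`. Gaps are at most 1, so the real supremum is a genuine one. -/
theorem samplingGap_le_supSamplingGap [IsProbabilityMeasure P] [FirstCountableTopology Θ]
    (hg : ∀ θ, Measurable (g θ))
    (hc : ∀ z, Continuous fun θ => g θ z) (h01 : ∀ θ z, g θ z ∈ Set.Icc (0 : ℝ) 1) {m : ℕ}
    (s : Fin m → α) (θ : Θ) : samplingGap P (g θ) s ≤ supSamplingGap P g s := by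
  have hcont : Continuous fun θ => samplingGap P (g θ) s := by
    have : Continuous fun θ => ∫ z, g θ z ∂P := by
      refine continuous_of_dominated (bound := fun _ => 1)
        (fun θ => (hg θ).aestronglyMeasurable) (fun θ => ae_of_all _ fun z => ?_)
        (integrable_const _) (ae_of_all _ hc)
      rw [Real.norm_eq_abs, abs_of_nonneg (h01 θ z).1]
      exact (h01 θ z).2
    exact this.sub (continuous_const.mul (continuous_finsetSum _ fun i _ => hc _))
  refine isClosed_property (TopologicalSpace.denseRange_denseSeq Θ)
    (isClosed_le hcont continuous_const) (fun k => ?_) θ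
  refine le_max_of_le_right (le_ciSup (f := fun k => samplingGap P (g _) s) ⟨1, ?_⟩ k)
  rintro _ ⟨k, rfl⟩
  exact samplingGap_le_one (hg _) (h01 _) s

end SamplingGap

/-! ### Concentration for i.i.d. samples. -/

section IID

variable {n : ℕ} {X : Set (EuclideanSpace ℝ (Fin n))} {P : Measure (LabelledExample n)}
  {Ω : Type u} [MeasurableSpace Ω] {μ : Measure Ω} {Z : ℕ → Ω → LabelledExample n}

theorem IsIIDSample.ae_mem (hZ : IsIIDSample μ P Z) (hP : IsLawOn X P) :
    ∀ᵐ ω ∂μ, ∀ i, Z i ω ∈ labelledSet X := by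
  rw [ae_all_iff]
  intro i
  have h := hP.2
  rw [← hZ.law i] at h
  exact ae_of_ae_map (hZ.measurable i).aemeasurable h

/-- Hoeffding's inequality for the sampling gap. -/
theorem IsIIDSample.measure_le_samplingGap (hZ : IsIIDSample μ P Z)
    {f : LabelledExample n → ℝ} (hf : Measurable f) (h01 : ∀ z, f z ∈ Set.Icc (0 : ℝ) 1)
    {η : ℝ} (hη : 0 ≤ η) {m : ℕ} (hm : 1 ≤ m) :
    μ {ω | η ≤ samplingGap P f (firstSamples Z m ω)} ≤
      ENNReal.ofReal (Real.exp (-2 * η ^ 2)) ^ m := by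
  have := hZ.isProbabilityMeasure
  have hm0 : (0 : ℝ) < m := by exact_mod_cast hm
  have hint : ∀ i, ∫ ω, f (Z i ω) ∂μ = ∫ z, f z ∂P := fun i => by
    rw [← hZ.law i, integral_map (hZ.measurable i).aemeasurable hf.aestronglyMeasurable]
  have hind : iIndepFun (fun i ω => ∫ z, f z ∂P - f (Z i ω)) μ :=
    hZ.indep.comp (fun _ z => ∫ z, f z ∂P - f z) fun _ => measurable_const.sub hf
  -- The variance proxy is `1/4`, whence the exponent `-(mη)² / (2m/4) = -2mη²`.
  have hsub : ∀ i < m, HasSubgaussianMGF (fun ω => ∫ z, f z ∂P - f (Z i ω))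
      ((‖(1 : ℝ) - 0‖₊ / 2) ^ 2) μ := fun i _ => by
    have h := (hasSubgaussianMGF_of_mem_Icc (μ := μ) (X := fun ω => f (Z i ω)) (a := 0) (b := 1)
      (hf.comp (hZ.measurable i)).aemeasurable (ae_of_all _ fun ω => h01 _)).neg
    rw [hint i] at h
    convert! h using 1
    ext ω
    simp
  have key := HasSubgaussianMGF.measure_sum_range_ge_le_of_iIndepFun hind hsub
    (ε := m * η) (by positivity)
  have hset : {ω | η ≤ samplingGap P f (firstSamples Z m ω)} =
      {ω | m * η ≤ ∑ i ∈ Finset.range m, (∫ z, f z ∂P - f (Z i ω))} := by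
    ext ω
    simp only [Set.mem_ofPred_eq, samplingGap, firstSamples, Finset.sum_sub_distrib,
      Finset.sum_const, Finset.card_range, nsmul_eq_mul,
      Fin.sum_univ_eq_sum_range (fun i => f (Z i ω))]
    rw [← mul_le_mul_iff_right₀ hm0]
    field_simp
  rw [hset, ← ENNReal.ofReal_pow (Real.exp_nonneg _), ← Real.exp_nat_mul]
  refine (ENNReal.le_ofReal_iff_toReal_le (measure_ne_top _ _) (Real.exp_nonneg _)).2
    (key.trans (le_of_eq ?_))
  congr 1
  simp
  field_simp

variable {Θ : Type*} [PseudoMetricSpace Θ] [CompactSpace Θ] [Nonempty Θ]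
  {g : Θ → LabelledExample n → ℝ}

/-- A uniform law of large numbers, uniform in the law, for a compact family of functions which is
uniformly Lipschitz in the parameter. -/
theorem exists_measure_supSamplingGap_le (hg : ∀ θ, Measurable (g θ))
    (h01 : ∀ θ z, g θ z ∈ Set.Icc (0 : ℝ) 1) {L : ℝ} (hL : 0 < L)
    (hLip : ∀ θ θ', ∀ z ∈ labelledSet X, |g θ z - g θ' z| ≤ L * dist θ θ')
    {ε : ℝ} (hε : 0 < ε) {δ : ℝ} (hδ : 0 < δ) :
    ∃ M : ℕ, ∀ P, IsLawOn X P →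
      ∀ (Ω : Type u) [MeasurableSpace Ω] (μ : Measure Ω) (Z : ℕ → Ω → LabelledExample n),
        IsIIDSample μ P Z →
          μ {ω | ∃ m, M ≤ m ∧ ε ≤ |supSamplingGap P g (firstSamples Z m ω)|} ≤
            ENNReal.ofReal δ := by
  -- Moving to a net point changes values by at most `ε/8`, hence gaps by at most `ε/4`; a gap above
  -- `ε/2` thus stays above `ε/4`.
  obtain ⟨t, -, htf, ht⟩ := finite_cover_balls_of_compact (isCompact_univ (X := Θ))
    (e := ε / (8 * L)) (by positivity)
  lift t to Finset Θ using htf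
  set q : ENNReal := ENNReal.ofReal (Real.exp (-2 * (ε / 4) ^ 2)) with hq
  have hq1 : q < 1 := by
    rw [hq, ENNReal.ofReal_lt_one, Real.exp_lt_one_iff]
    nlinarith [pow_pos (show 0 < ε / 4 by positivity) 2]
  have hsum : ∑' m : ℕ, (t.card : ENNReal) * q ^ m ≠ ⊤ := by
    rw [ENNReal.tsum_mul_left, ENNReal.tsum_geometric]
    refine ENNReal.mul_ne_top (ENNReal.natCast_ne_top _) ?_
    simpa [tsub_eq_zero_iff_le] using hq1
  -- The tail of the geometric series depends only on the size of the net and on `ε`, so `M` is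
  -- chosen before `P`.
  obtain ⟨M, hM, hM1⟩ := (((ENNReal.tendsto_sum_nat_add _ hsum).eventually
    (ge_mem_nhds (ENNReal.ofReal_pos.2 hδ))).and (eventually_ge_atTop 1)).exists
  refine ⟨M, fun P hP Ω _ μ Z hZ => ?_⟩
  have := hP.1
  refine le_trans ?_ hM
  calc μ {ω | ∃ m, M ≤ m ∧ ε ≤ |supSamplingGap P g (firstSamples Z m ω)|}
      ≤ μ (⋃ k : ℕ, ⋃ θ ∈ t,
          {ω | ε / 4 ≤ samplingGap P (g θ) (firstSamples Z (k + M) ω)}) := by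
        refine measure_mono_ae ?_
        filter_upwards [hZ.ae_mem hP] with ω hω
        rintro ⟨m, hMm, hm⟩
        rw [abs_of_nonneg (supSamplingGap_nonneg _)] at hm
        obtain ⟨θ, hθ⟩ := exists_le_samplingGap hε hm (half_lt_self hε)
        obtain ⟨θ', hθ't, hθ'⟩ := Set.mem_iUnion₂.1 (ht (Set.mem_univ θ))
        have hd : L * dist θ θ' ≤ ε / 8 := by
          have := mul_le_mul_of_nonneg_left (Metric.mem_ball.1 hθ').le hL.le
          calc _ ≤ _ := this
            _ = ε / 8 := by field_simp
        have := samplingGap_le_add (P := P) (hg θ) (hg θ') (h01 θ) (h01 θ') hP.2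
          (fun z hz => (hLip θ θ' z hz).trans hd) (hM1.trans hMm)
          (s := firstSamples Z m ω) (fun i => hω i)
        refine Set.mem_iUnion.2 ⟨m - M, Set.mem_iUnion₂.2 ⟨θ', hθ't, ?_⟩⟩
        rw [Nat.sub_add_cancel hMm]
        change ε / 4 ≤ _
        linarith
    _ ≤ ∑' k : ℕ, μ (⋃ θ ∈ t,
          {ω | ε / 4 ≤ samplingGap P (g θ) (firstSamples Z (k + M) ω)}) := measure_iUnion_le _
    _ ≤ ∑' k : ℕ, (t.card : ENNReal) * q ^ (k + M) := by
        refine ENNReal.tsum_le_tsum fun k => (measure_biUnion_finset_le _ _).trans ?_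
        rw [← nsmul_eq_mul]
        exact Finset.sum_le_card_nsmul _ _ _ fun θ _ =>
          hZ.measure_le_samplingGap (hg θ) (h01 θ) (by positivity) (by omega)

end IID

/-- Almost sure convergence to zero follows from bounds on the tail events. -/
theorem ae_tendsto_zero_of_measure_exists_ge_le {Ω : Type*} [MeasurableSpace Ω] {μ : Measure Ω}
    {Y : ℕ → Ω → ℝ}
    (h : ∀ ε : ℝ, 0 < ε → ∀ δ : ℝ, 0 < δ → ∃ M : ℕ,
      μ {ω | ∃ m, M ≤ m ∧ ε ≤ |Y m ω|} ≤ ENNReal.ofReal δ) :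
    ∀ᵐ ω ∂μ, Tendsto (fun m => Y m ω) atTop (𝓝 0) := by
  have key : ∀ k : ℕ, ∀ᵐ ω ∂μ, ∃ M, ∀ m, M ≤ m → |Y m ω| < 1 / ((k : ℝ) + 1) := by
    intro k
    rw [ae_iff]
    refine le_antisymm (ENNReal.le_of_forall_pos_le_add fun δ hδ _ => ?_) zero_le
    obtain ⟨M, hM⟩ := h (1 / ((k : ℝ) + 1)) (by positivity) δ hδ
    rw [zero_add, ← ENNReal.ofReal_coe_nnreal]
    refine le_trans (measure_mono fun ω hω => ?_) hM
    simp only [Set.mem_ofPred_eq, not_exists, not_forall, not_lt] at hω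
    obtain ⟨m, hm, hm'⟩ := hω M
    exact ⟨m, hm, hm'⟩
  filter_upwards [ae_all_iff.2 key] with ω hω
  rw [Metric.tendsto_atTop]
  intro ε hε
  obtain ⟨k, hk⟩ := exists_nat_one_div_lt hε
  obtain ⟨M, hM⟩ := hω k
  exact ⟨M, fun m hm => by simpa using (hM m hm).trans hk⟩

/-- The scaled hinge loss `max (t - y (⟨v, K⁻¹ x⟩ + b), 0)`, truncated at `1`, with parameters
`(t, v, b)`. -/
noncomputable def clippedHinge {n : ℕ} (K : ℝ) (θ : ℝ × EuclideanSpace ℝ (Fin n) × ℝ)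
    (z : LabelledExample n) : ℝ :=
  min (max (θ.1 - z.2 * affineScore θ.2.1 θ.2.2 (K⁻¹ • z.1)) 0) 1

/-! ### The clipped hinge family and its relation to the two losses. -/

section ClippedHinge

variable {n : ℕ} {X : Set (EuclideanSpace ℝ (Fin n))}

theorem continuous_clippedHinge (K : ℝ) :
    Continuous fun p : (ℝ × EuclideanSpace ℝ (Fin n) × ℝ) × LabelledExample n =>
      clippedHinge K p.1 p.2 := by
  unfold clippedHinge affineScore
  fun_prop

theorem clippedHinge_mem_Icc (K : ℝ) (θ : ℝ × EuclideanSpace ℝ (Fin n) × ℝ)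
    (z : LabelledExample n) : clippedHinge K θ z ∈ Set.Icc (0 : ℝ) 1 :=
  ⟨le_min (le_max_right _ _) zero_le_one, min_le_right _ _⟩

theorem normBound_nonneg : 0 ≤ normBound X :=
  Real.sSup_nonneg (by rintro _ ⟨x, -, rfl⟩; exact norm_nonneg x)

theorem norm_le_normBound (hX : Bornology.IsBounded X) {x : EuclideanSpace ℝ (Fin n)}
    (hx : x ∈ X) : ‖x‖ ≤ normBound X := by
  obtain ⟨C, hC⟩ := hX.exists_norm_le
  exact le_csSup ⟨C, by rintro _ ⟨x, hx, rfl⟩; exact hC x hx⟩ ⟨x, hx, rfl⟩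

theorem abs_inner_le_of_mem (hX : Bornology.IsBounded X) {x : EuclideanSpace ℝ (Fin n)}
    (hx : x ∈ X) (w : EuclideanSpace ℝ (Fin n)) : |inner ℝ w x| ≤ normBound X * ‖w‖ := by
  rw [mul_comm]
  exact (abs_real_inner_le_norm w x).trans
    (mul_le_mul_of_nonneg_left (norm_le_normBound hX hx) (norm_nonneg w))

theorem norm_inv_normBound_smul_le (hX : Bornology.IsBounded X) {x : EuclideanSpace ℝ (Fin n)}
    (hx : x ∈ X) : ‖(normBound X)⁻¹ • x‖ ≤ 1 := by
  rw [norm_smul, norm_inv, Real.norm_of_nonneg normBound_nonneg]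
  exact inv_mul_le_one_of_le₀ (norm_le_normBound hX hx) normBound_nonneg

/-- When `K = 0` the inverse is the default value 0, but then `x = 0` as well. -/
theorem inner_normBound_smul (hX : Bornology.IsBounded X) {x : EuclideanSpace ℝ (Fin n)}
    (hx : x ∈ X) (w : EuclideanSpace ℝ (Fin n)) :
    inner ℝ (normBound X • w) ((normBound X)⁻¹ • x) = inner ℝ w x := by
  rcases eq_or_ne (normBound X) 0 with h | h
  · have : x = 0 := norm_le_zero_iff.1 (h ▸ norm_le_normBound hX hx)
    simp [this]
  · rw [real_inner_smul_left, real_inner_smul_right, mul_inv_cancel_left₀ h]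

theorem abs_label {z : LabelledExample n} (hz : z ∈ labelledSet X) : |z.2| = 1 := by
  rcases hz.2 with h | h
  · rw [h]; simp
  · rw [Set.mem_singleton_iff.1 h]; simp

/-- Clipping is 1-Lipschitz, and each of `t`, `v`, `b` contributes at most one `dist θ θ'`, since
`‖K⁻¹ x‖ ≤ 1` and `|y| = 1`. -/
theorem abs_clippedHinge_sub_le (hX : Bornology.IsBounded X)
    (θ θ' : ℝ × EuclideanSpace ℝ (Fin n) × ℝ) {z : LabelledExample n} (hz : z ∈ labelledSet X) :
    |clippedHinge (normBound X) θ z - clippedHinge (normBound X) θ' z| ≤ 3 * dist θ θ' := by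
  have h1 : |θ.1 - θ'.1| ≤ dist θ θ' := le_max_left _ _
  have h2 : ‖θ.2.1 - θ'.2.1‖ ≤ dist θ θ' := by
    rw [← dist_eq_norm]
    exact (le_max_left _ _).trans (le_max_right _ _)
  have h3 : |θ.2.2 - θ'.2.2| ≤ dist θ θ' := (le_max_right _ _).trans (le_max_right _ _)
  set u := (normBound X)⁻¹ • z.1
  have hu : ‖u‖ ≤ 1 := norm_inv_normBound_smul_le hX hz.1
  have h4 : |inner ℝ (θ.2.1 - θ'.2.1) u| ≤ dist θ θ' := by
    refine (abs_real_inner_le_norm _ _).trans ?_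
    nlinarith [norm_nonneg (θ.2.1 - θ'.2.1)]
  have hsub : (θ.1 - z.2 * affineScore θ.2.1 θ.2.2 u) -
      (θ'.1 - z.2 * affineScore θ'.2.1 θ'.2.2 u) =
      (θ.1 - θ'.1) - z.2 * (inner ℝ (θ.2.1 - θ'.2.1) u + (θ.2.2 - θ'.2.2)) := by
    rw [inner_sub_left]
    unfold affineScore
    ring
  calc |clippedHinge (normBound X) θ z - clippedHinge (normBound X) θ' z|
      ≤ |max (θ.1 - z.2 * affineScore θ.2.1 θ.2.2 u) 0 -
          max (θ'.1 - z.2 * affineScore θ'.2.1 θ'.2.2 u) 0| := abs_inf_sub_inf_le_abs _ _ _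
    _ ≤ |(θ.1 - z.2 * affineScore θ.2.1 θ.2.2 u) -
          (θ'.1 - z.2 * affineScore θ'.2.1 θ'.2.2 u)| := abs_sup_sub_sup_le_abs _ _ _
    _ ≤ |θ.1 - θ'.1| + |z.2 * (inner ℝ (θ.2.1 - θ'.2.1) u + (θ.2.2 - θ'.2.2))| := by
        rw [hsub]; exact abs_sub _ _
    _ ≤ |θ.1 - θ'.1| + (|inner ℝ (θ.2.1 - θ'.2.1) u| + |θ.2.2 - θ'.2.2|) := by
        rw [abs_mul, abs_label hz, one_mul]; gcongr; exact abs_add_le _ _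
    _ ≤ 3 * dist θ θ' := by linarith

theorem hingeLoss_nonneg (w : EuclideanSpace ℝ (Fin n)) (b : ℝ) (z : LabelledExample n) :
    0 ≤ hingeLoss w b z := le_max_right _ _

theorem hingeLoss_le (hX : Bornology.IsBounded X) (w : EuclideanSpace ℝ (Fin n)) (b : ℝ)
    {z : LabelledExample n} (hz : z ∈ labelledSet X) :
    hingeLoss w b z ≤ 1 + normBound X * ‖w‖ + |b| := by
  have h1 : |z.2 * affineScore w b z.1| ≤ normBound X * ‖w‖ + |b| := by
    rw [abs_mul, abs_label hz, one_mul]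
    exact (abs_add_le _ _).trans (add_le_add (abs_inner_le_of_mem hX hz.1 w) le_rfl)
  have h2 := abs_le.1 h1
  refine max_le (by linarith) ?_
  linarith [abs_nonneg (z.2 * affineScore w b z.1)]

theorem measurable_hingeLoss (w : EuclideanSpace ℝ (Fin n)) (b : ℝ) :
    Measurable (hingeLoss w b) := by
  unfold hingeLoss affineScore
  exact Continuous.measurable (by fun_prop)

theorem measurable_zeroOneLoss (w : EuclideanSpace ℝ (Fin n)) (b : ℝ) :
    Measurable (zeroOneLoss w b) := by
  have hs : Measurable Real.sign := by
    have : Real.sign = fun r => if r < 0 then (-1 : ℝ) else if 0 < r then 1 else 0 := by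
      ext r; rfl
    rw [this]
    exact Measurable.ite measurableSet_Iio measurable_const
      (Measurable.ite measurableSet_Ioi measurable_const measurable_const)
  have ha : Measurable fun z : LabelledExample n => affineScore w b z.1 := by
    unfold affineScore
    exact Continuous.measurable (by fun_prop)
  exact Measurable.ite (measurableSet_eq_fun measurable_snd (hs.comp ha)).compl
    measurable_const measurable_const

theorem zeroOneLoss_mem_Icc (w : EuclideanSpace ℝ (Fin n)) (b : ℝ) (z : LabelledExample n) :
    zeroOneLoss w b z ∈ Set.Icc (0 : ℝ) 1 := by
  unfold zeroOneLoss
  split_ifs <;> simp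

theorem clippedHinge_inv_smul (hX : Bornology.IsBounded X) (w : EuclideanSpace ℝ (Fin n)) (b : ℝ)
    {T : ℝ} (hT : T = 1 + normBound X * ‖w‖ + |b|) {z : LabelledExample n}
    (hz : z ∈ labelledSet X) :
    clippedHinge (normBound X) (T⁻¹ • (1, normBound X • w, b)) z = T⁻¹ * hingeLoss w b z := by
  have hT0 : 0 < T := by
    have := mul_nonneg (normBound_nonneg (X := X)) (norm_nonneg w)
    have := abs_nonneg b
    linarith
  have h1 : T⁻¹ * hingeLoss w b z ≤ 1 :=
    inv_mul_le_one_of_le₀ (hT ▸ hingeLoss_le hX w b hz) hT0.le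
  have h2 : max (T⁻¹ - z.2 * affineScore (T⁻¹ • normBound X • w) (T⁻¹ * b)
      ((normBound X)⁻¹ • z.1)) 0 = T⁻¹ * hingeLoss w b z := by
    unfold hingeLoss affineScore
    rw [real_inner_smul_left, inner_normBound_smul hX hz.1,
      mul_max_of_nonneg _ _ (inv_nonneg.2 hT0.le), mul_zero]
    congr 1
    ring
  have h3 : clippedHinge (normBound X) (T⁻¹ • (1, normBound X • w, b)) z =
      min (T⁻¹ * hingeLoss w b z) 1 := by
    rw [← h2]
    simp [clippedHinge]
  rw [h3, min_eq_left h1]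

/-- Once `|b| ≥ R`, the offset outweighs `⟨w, x⟩` by at least 1: the clipped loss is 0 if `b` has
the sign of the label and 1 otherwise, whatever the size of `b`. -/
theorem clippedHinge_clip (hX : Bornology.IsBounded X) {w : EuclideanSpace ℝ (Fin n)} (b : ℝ)
    {R : ℝ} (hR : 1 + normBound X * ‖w‖ ≤ R) {z : LabelledExample n} (hz : z ∈ labelledSet X) :
    clippedHinge (normBound X) (1, normBound X • w, max (-R) (min b R)) z =
      min (hingeLoss w b z) 1 := by
  have hi := abs_le.1 (abs_inner_le_of_mem hX hz.1 w)
  have hn := mul_nonneg (normBound_nonneg (X := X)) (norm_nonneg w)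
  simp only [clippedHinge, hingeLoss, affineScore, inner_normBound_smul hX hz.1]
  have hy : z.2 = -1 ∨ z.2 = 1 := hz.2
  rcases le_total b R with hb | hb
  · rw [min_eq_left hb]
    rcases le_total (-R) b with hb' | hb'
    · rw [max_eq_right hb']
    · rw [max_eq_left hb']
      rcases hy with hy | hy <;> rw [hy]
      · rw [max_eq_right (by linarith), max_eq_right (by linarith)]
      · rw [min_eq_right (le_max_of_le_left (by linarith)),
          min_eq_right (le_max_of_le_left (by linarith))]
  · rw [min_eq_right hb, max_eq_right (show -R ≤ R by linarith)]
    rcases hy with hy | hy <;> rw [hy]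
    · rw [min_eq_right (le_max_of_le_left (by linarith)),
        min_eq_right (le_max_of_le_left (by linarith))]
    · rw [max_eq_right (by linarith), max_eq_right (by linarith)]

theorem zeroOneLoss_le (w : EuclideanSpace ℝ (Fin n)) (b : ℝ) {z : LabelledExample n}
    (hz : z ∈ labelledSet X) : zeroOneLoss w b z ≤ min (hingeLoss w b z) 1 := by
  refine le_min ?_ (zeroOneLoss_mem_Icc w b z).2
  unfold zeroOneLoss
  split_ifs with h
  · refine le_max_of_le_left ?_
    rcases hz.2 with hy | hy
    · rw [hy] at h ⊢
      by_contra! hc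
      exact h (Real.sign_of_neg (by linarith)).symm
    · rw [Set.mem_singleton_iff.1 hy] at h ⊢
      by_contra! hc
      exact h (Real.sign_of_pos (by linarith)).symm
  · exact hingeLoss_nonneg w b z

/-! ### Loss bounds from a bound on the sampling gaps. -/

variable {P : Measure (LabelledExample n)}

theorem integrable_zeroOneLoss (hP : IsLawOn X P) (w : EuclideanSpace ℝ (Fin n)) (b : ℝ) :
    Integrable (zeroOneLoss w b) P :=
  have := hP.1
  integrable_of_mem_unitInterval (measurable_zeroOneLoss w b) (zeroOneLoss_mem_Icc w b)

theorem integrable_hingeLoss (hX : Bornology.IsBounded X) (hP : IsLawOn X P)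
    (w : EuclideanSpace ℝ (Fin n)) (b : ℝ) : Integrable (hingeLoss w b) P := by
  have := hP.1
  refine Integrable.of_mem_Icc 0 (1 + normBound X * ‖w‖ + |b|)
    (measurable_hingeLoss w b).aemeasurable ?_
  filter_upwards [hP.2] with z hz
  exact ⟨hingeLoss_nonneg w b z, hingeLoss_le hX w b hz⟩

theorem empiricalHingeLoss_nonneg (w : EuclideanSpace ℝ (Fin n)) (b : ℝ) {m : ℕ}
    (s : Fin m → LabelledExample n) : 0 ≤ empiricalHingeLoss w b s :=
  mul_nonneg (by positivity) (Finset.sum_nonneg fun i _ => hingeLoss_nonneg w b _)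

theorem measurable_clippedHinge (K : ℝ) (θ : ℝ × EuclideanSpace ℝ (Fin n) × ℝ) :
    Measurable (clippedHinge K θ) :=
  ((continuous_clippedHinge K).comp (Continuous.prodMk_right θ)).measurable

theorem integral_hingeLoss_le (hX : Bornology.IsBounded X) (hP : IsLawOn X P) {m : ℕ}
    {s : Fin m → LabelledExample n} (hs : ∀ i, s i ∈ labelledSet X) {Γ R : ℝ} (hR : 1 ≤ R)
    (hΓ : ∀ θ ∈ Metric.closedBall (0 : ℝ × EuclideanSpace ℝ (Fin n) × ℝ) R,
      samplingGap P (clippedHinge (normBound X) θ) s ≤ Γ)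
    (w : EuclideanSpace ℝ (Fin n)) (b : ℝ) :
    ∫ z, hingeLoss w b z ∂P ≤
      Γ * (1 + normBound X * ‖w‖ + |b|) + empiricalHingeLoss w b s := by
  obtain ⟨T, hT⟩ : ∃ T, T = 1 + normBound X * ‖w‖ + |b| := ⟨_, rfl⟩
  have hn := mul_nonneg (normBound_nonneg (X := X)) (norm_nonneg w)
  have hT0 : 0 < T := by linarith [abs_nonneg b]
  have hmem : T⁻¹ • ((1 : ℝ), normBound X • w, b) ∈
      Metric.closedBall (0 : ℝ × EuclideanSpace ℝ (Fin n) × ℝ) R := by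
    rw [mem_closedBall_zero_iff, norm_smul, norm_inv, Real.norm_of_nonneg hT0.le]
    refine (inv_mul_le_one_of_le₀ ?_ hT0.le).trans hR
    -- The product norm is the maximum, and each of `1`, `K‖w‖`, `|b|` is at most `T`.
    refine max_le ?_ (max_le ?_ ?_)
    · simp only [norm_one]; linarith [abs_nonneg b]
    · rw [norm_smul, Real.norm_of_nonneg normBound_nonneg]; linarith [abs_nonneg b]
    · rw [Real.norm_eq_abs]; linarith
  have h := hΓ _ hmem
  have h1 : ∫ z, clippedHinge (normBound X) (T⁻¹ • (1, normBound X • w, b)) z ∂P =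
      T⁻¹ * ∫ z, hingeLoss w b z ∂P := by
    rw [← integral_const_mul]
    refine integral_congr_ae ?_
    filter_upwards [hP.2] with z hz
    exact clippedHinge_inv_smul hX w b hT hz
  have h2 : (1 / (m : ℝ)) * ∑ i,
      clippedHinge (normBound X) (T⁻¹ • (1, normBound X • w, b)) (s i) =
      T⁻¹ * empiricalHingeLoss w b s := by
    rw [Finset.sum_congr rfl fun i _ => clippedHinge_inv_smul hX w b hT (hs i),
      ← Finset.mul_sum, empiricalHingeLoss]
    ring
  rw [samplingGap, h1, h2, ← mul_sub, inv_mul_le_iff₀ hT0] at h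
  rw [← hT]
  linarith

theorem integral_zeroOneLoss_le (hX : Bornology.IsBounded X) (hP : IsLawOn X P) {m : ℕ}
    {s : Fin m → LabelledExample n} (hs : ∀ i, s i ∈ labelledSet X) {Γ c : ℝ} (hc : 0 < c)
    (hΓ0 : 0 ≤ Γ)
    (hΓ : ∀ θ ∈ Metric.closedBall (0 : ℝ × EuclideanSpace ℝ (Fin n) × ℝ)
      (1 + normBound X / c), samplingGap P (clippedHinge (normBound X) θ) s ≤ Γ)
    (w : EuclideanSpace ℝ (Fin n)) (b : ℝ) :
    ∫ z, zeroOneLoss w b z ∂P ≤ Γ + c * ‖w‖ + empiricalHingeLoss w b s := by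
  have := hP.1
  have hemp := empiricalHingeLoss_nonneg w b s
  have hint := integrable_zeroOneLoss hP w b
  rcases le_total 1 (c * ‖w‖) with hw | hw
  · have h1 : ∫ z, zeroOneLoss w b z ∂P ≤ ∫ _, (1 : ℝ) ∂P :=
      integral_mono hint (integrable_const _) fun z => (zeroOneLoss_mem_Icc w b z).2
    simp only [integral_const, probReal_univ, smul_eq_mul, mul_one] at h1
    linarith
  have hK := normBound_nonneg (X := X)
  obtain ⟨R, hRdef⟩ : ∃ R, R = 1 + normBound X / c := ⟨_, rfl⟩
  rw [← hRdef] at hΓ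
  have hwK : normBound X * ‖w‖ ≤ normBound X / c := by
    rw [div_eq_mul_inv]
    gcongr
    rwa [← one_div, le_div_iff₀ hc, mul_comm]
  have hR : 1 + normBound X * ‖w‖ ≤ R := by rw [hRdef]; gcongr
  have hR1 : 1 ≤ R := by linarith [mul_nonneg hK (norm_nonneg w)]
  have hmem : ((1 : ℝ), normBound X • w, max (-R) (min b R)) ∈
      Metric.closedBall (0 : ℝ × EuclideanSpace ℝ (Fin n) × ℝ) R := by
    rw [mem_closedBall_zero_iff]
    refine max_le ?_ (max_le ?_ ?_)
    · simpa using hR1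
    · rw [norm_smul, Real.norm_of_nonneg hK]; linarith
    · rw [Real.norm_eq_abs, abs_le]
      exact ⟨le_max_left _ _, max_le (by linarith) (min_le_right _ _)⟩
  have h := hΓ _ hmem
  have h1 : ∫ z, zeroOneLoss w b z ∂P ≤
      ∫ z, clippedHinge (normBound X) (1, normBound X • w, max (-R) (min b R)) z ∂P := by
    refine integral_mono_ae hint (integrable_of_mem_unitInterval
      (measurable_clippedHinge _ _) (clippedHinge_mem_Icc _ _)) ?_
    filter_upwards [hP.2] with z hz
    rw [clippedHinge_clip hX b hR hz]
    exact zeroOneLoss_le w b hz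
  have h2 : (1 / (m : ℝ)) * ∑ i,
      clippedHinge (normBound X) (1, normBound X • w, max (-R) (min b R)) (s i) ≤
      empiricalHingeLoss w b s := by
    unfold empiricalHingeLoss
    gcongr with i
    rw [clippedHinge_clip hX b hR (hs i)]
    exact min_le_left _ _
  have h3 : 0 ≤ c * ‖w‖ := by positivity
  unfold samplingGap at h
  linarith

end ClippedHinge

/-! ### The statistic and the theorem. -/

/-- For each `c`, a nonnegative statistic which tends to `0` uniformly in the law and dominates the
sampling gaps of all clipped hinge losses with parameters of norm at most `1 + K / c`. -/
theorem exists_deviation_bound (n : ℕ) (X : Set (EuclideanSpace ℝ (Fin n)))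
    (hX : Bornology.IsBounded X) {c : ℝ} (hc : 0 < c) :
    ∃ γ : Measure (LabelledExample n) → (m : ℕ) → (Fin m → LabelledExample n) → ℝ,
      (∀ P, IsLawOn X P → ∀ m, Measurable (γ P m)) ∧
      (∀ ε : ℝ, 0 < ε → ∀ δ : ℝ, 0 < δ → ∃ M : ℕ, ∀ P, IsLawOn X P →
        ∀ (Ω : Type u) [MeasurableSpace Ω] (μ : Measure Ω) (Z : ℕ → Ω → LabelledExample n),
          IsIIDSample μ P Z →
            μ {ω | ∃ m, M ≤ m ∧ ε ≤ |γ P m (firstSamples Z m ω)|} ≤ ENNReal.ofReal δ) ∧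
      (∀ P, IsLawOn X P → ∀ m (s : Fin m → LabelledExample n), 0 ≤ γ P m s ∧
        ∀ θ ∈ Metric.closedBall (0 : ℝ × EuclideanSpace ℝ (Fin n) × ℝ) (1 + normBound X / c),
          samplingGap P (clippedHinge (normBound X) θ) s ≤ γ P m s) := by
  set B := Metric.closedBall (0 : ℝ × EuclideanSpace ℝ (Fin n) × ℝ) (1 + normBound X / c)
  have : CompactSpace B := isCompact_iff_compactSpace.1 (isCompact_closedBall _ _)
  have : Nonempty B := ⟨0, Metric.mem_closedBall_self
    (by have := div_nonneg (normBound_nonneg (X := X)) hc.le; linarith)⟩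
  let g : B → LabelledExample n → ℝ := fun θ => clippedHinge (normBound X) θ.1
  have hg : ∀ θ, Measurable (g θ) := fun θ => measurable_clippedHinge _ _
  have h01 : ∀ θ z, g θ z ∈ Set.Icc (0 : ℝ) 1 := fun θ => clippedHinge_mem_Icc _ _
  have hcont : ∀ z, Continuous fun θ => g θ z := fun z =>
    (continuous_clippedHinge _).comp (continuous_subtype_val.prodMk continuous_const)
  refine ⟨fun P m s => supSamplingGap P g s, fun P hP m => ?_, fun ε hε δ hδ => ?_,
    fun P hP m s => ⟨supSamplingGap_nonneg s, fun θ hθ => ?_⟩⟩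
  · exact measurable_supSamplingGap hg m
  · exact exists_measure_supSamplingGap_le hg h01 (L := 3) (by norm_num)
      (fun θ θ' z hz => abs_clippedHinge_sub_le hX θ.1 θ'.1 hz) hε hδ
  · have := hP.1
    exact samplingGap_le_supSamplingGap hg hcont h01 s ⟨θ, hθ⟩

theorem mainTheorem4 (n : ℕ) (X : Set (EuclideanSpace ℝ (Fin n))) (hX : Bornology.IsBounded X) :
    ∃ γ : Measure (LabelledExample n) → ℝ → (m : ℕ) → (Fin m → LabelledExample n) → ℝ,
      -- each `γ P c m` is a random variable that is a function of the first `m` samples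
      (∀ P, IsLawOn X P → ∀ c : ℝ, 0 < c → ∀ m, Measurable (γ P c m)) ∧
      -- almost sure convergence to `0`
      (∀ c : ℝ, 0 < c → ∀ P, IsLawOn X P →
        ∀ (Ω : Type u) [MeasurableSpace Ω] (μ : Measure Ω) (Z : ℕ → Ω → LabelledExample n),
          IsIIDSample μ P Z →
            ∀ᵐ ω ∂μ, Tendsto (fun m => γ P c m (firstSamples Z m ω)) atTop (𝓝 0)) ∧
      -- uniformity in the law: `M` does not depend on `P`
      (∀ c : ℝ, 0 < c → ∀ ε : ℝ, 0 < ε → ∀ δ : ℝ, 0 < δ → ∃ M : ℕ, ∀ P, IsLawOn X P →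
        ∀ (Ω : Type u) [MeasurableSpace Ω] (μ : Measure Ω) (Z : ℕ → Ω → LabelledExample n),
          IsIIDSample μ P Z →
            μ {ω | ∃ m, M ≤ m ∧ ε ≤ |γ P c m (firstSamples Z m ω)|} ≤ ENNReal.ofReal δ) ∧
      -- the two loss bounds, for every realization of the sample and uniformly in `(w, b)`
      (∀ P, IsLawOn X P → ∀ c : ℝ, 0 < c → ∀ m : ℕ, 1 ≤ m →
        ∀ s : Fin m → LabelledExample n, (∀ i, s i ∈ labelledSet X) →
          ∀ (w : EuclideanSpace ℝ (Fin n)) (b : ℝ),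
            (Integrable (zeroOneLoss w b) P ∧
              ∫ z, zeroOneLoss w b z ∂P ≤
                γ P c m s + c * ‖w‖ + empiricalHingeLoss w b s) ∧
            (Integrable (hingeLoss w b) P ∧
              ∫ z, hingeLoss w b z ∂P ≤
                γ P c m s * (1 + normBound X * ‖w‖ + |b|) + c * ‖w‖ +
                  empiricalHingeLoss w b s)) := by
  have key := fun c (hc : 0 < c) => exists_deviation_bound.{u} n X hX hc
  choose! γ hmeas htail hbound using key
  refine ⟨fun P c => γ c P, fun P hP c hc m => hmeas c hc P hP m, fun c hc P hP Ω _ μ Z hZ => ?_,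
    fun c hc ε hε δ hδ => htail c hc ε hε δ hδ, fun P hP c hc m _ s hs w b => ?_⟩
  · refine ae_tendsto_zero_of_measure_exists_ge_le fun ε hε δ hδ => ?_
    obtain ⟨M, hM⟩ := htail c hc ε hε δ hδ
    exact ⟨M, hM P hP Ω μ Z hZ⟩
  · obtain ⟨h0, hΓ⟩ := hbound c hc P hP m s
    have hR : 1 ≤ 1 + normBound X / c :=
      le_add_of_nonneg_right (div_nonneg normBound_nonneg hc.le)
    have hh := integral_hingeLoss_le hX hP hs hR hΓ w b
    -- In the hinge bound this term is pure slack.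
    have hcw : 0 ≤ c * ‖w‖ := by positivity
    exact ⟨⟨integrable_zeroOneLoss hP w b, integral_zeroOneLoss_le hX hP hs hc h0 hΓ w b⟩,
      integrable_hingeLoss hX hP w b, by linarith⟩
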